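/- Let $N\ge 0$ (with $0^0=1$) and let $E=\{1,\dots,N\}^2$. For an $N\times N$ real matrix $\beta=(\beta_i^j)$ let $\beta.*(1-\beta)$ be the matrix with entries $\beta_i^j(1-\beta_i^j)$. Given $p_i^j\ge 0$ for $(i,j)\in E$ and a temperature $T>0$, call $\beta$ a BP (belief propagation) belief matrix if it is doubly stochastic (non-negative entries, all row and column sums equal to $1$) and there are real numbers $\mu_1,\dots,\mu_N$ and $\mu^1,\dots,\mu^N$ such that $$\beta_i^j(1-\beta_i^j)=(p_i^j)^{1/T}\exp(\mu_i+\mu^j)\qquad\text{for all }(i,j)\in E .$$ Then every BP belief matrix $\beta$, and more generally every doubly stochastic $N\times N$ matrix $\beta$, satisfies $$\operatorname{Perm}\bigl(\beta.*(1-\beta)\bigr)\;\ge\;\frac{N!}{N^N}\prod_{(i,j)\in E}(1-\beta_i^j)^{\beta_i^j}.$$ -/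

import Mathlib

open scoped Nat

/-- The entrywise product `β .* (1 - β)`, whose `(i, j)` entry is `β i j * (1 - β i j)`
(here `1` stands for the all-ones matrix, not for the identity matrix). -/
def beliefVariance {N : ℕ} (β : Matrix (Fin N) (Fin N) ℝ) : Matrix (Fin N) (Fin N) ℝ :=
  Matrix.of fun i j => β i j * (1 - β i j)

/-- `β` is a belief propagation (BP) belief matrix for the perfect matching model on `K_{N,N}` with
edge weights `(p i j) ^ (1 / T)`: it is doubly stochastic and it solves, for some Lagrange
multipliers `μ` (rows) and `ν` (columns), the stationarity equations of the Bethe free energy. -/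
structure IsBPBelief {N : ℕ} (p : Matrix (Fin N) (Fin N) ℝ) (T : ℝ)
    (β : Matrix (Fin N) (Fin N) ℝ) : Prop where
  doublyStochastic : β ∈ doublyStochastic ℝ (Fin N)
  stationary : ∃ μ ν : Fin N → ℝ, ∀ i j,
    β i j * (1 - β i j) = p i j ^ (1 / T) * Real.exp (μ i + ν j)

/-
The bound is an instance of Gurvits' inequality: if `p` is a stable homogeneous polynomial of
degree `n` in `n` variables with nonnegative coefficients, then its coefficient at `x₁ ⋯ xₙ` is at
least `n! / n ^ n` times its capacity `inf p x / (x₁ ⋯ xₙ)`. Fixing all variables but one at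
positive values leaves a univariate polynomial `Q` with only negative roots, so by AM-GM
`Q t ≤ Q 0 * (1 + t * Q' 0 / (n * Q 0)) ^ n`; choosing `t` optimally shows that passing from `p` to
its coefficient at the first power of that variable costs a factor `((n - 1) / n) ^ (n - 1)` of
capacity. The Gauss–Lucas theorem keeps that coefficient stable, and the factors multiply to
`n! / n ^ n`. The permanent of `A` is such a coefficient of the product of the row forms of `A`.
For `A = B ⊙ W` with `B` doubly stochastic, the weighted AM-GM inequality in each row, with weights
from `B`, bounds the capacity of that product below by `∏ W i j ^ B i j`.
-/

section Univariate

open Polynomial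

theorem eval_zero_derivative {R : Type*} [Semiring R] (Q : R[X]) :
    Q.derivative.eval 0 = Q.coeff 1 := by
  simp [← coeff_zero_eq_eval_zero, coeff_derivative]

theorem multiset_prod_le_pow_sum_div_card (s : Multiset ℝ) (hs : ∀ a ∈ s, 0 ≤ a) :
    s.prod ≤ (s.sum / s.card) ^ s.card := by
  rcases eq_or_ne s 0 with rfl | hs0
  · simp
  have hcard : 0 < s.card := Multiset.card_pos.mpr hs0
  have hnonneg : ∀ a : s, 0 ≤ (a : ℝ) := fun a => hs _ (Multiset.coe_mem (x := a))
  have amgm := Real.geom_mean_le_arith_mean Finset.univ (fun _ : s => (1 : ℝ)) (fun a => (a : ℝ))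
    (fun _ _ => zero_le_one) (by simpa using hcard) fun a _ => hnonneg a
  have hprod : ∏ a : s, (a : ℝ) = s.prod := congrArg Multiset.prod s.map_univ_coe
  have hsum : ∑ a : s, (a : ℝ) = s.sum := congrArg Multiset.sum s.map_univ_coe
  simp only [Real.rpow_one, one_mul, Finset.sum_const, Finset.card_univ, Multiset.card_coe,
    nsmul_eq_mul, mul_one, hprod, hsum] at amgm
  have hprod0 : 0 ≤ s.prod := Multiset.prod_nonneg hs
  calc s.prod = (s.prod ^ (s.card : ℝ)⁻¹) ^ s.card :=
        (Real.rpow_inv_natCast_pow hprod0 hcard.ne').symm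
    _ ≤ (s.sum / s.card) ^ s.card := by gcongr

theorem eval_le_pow_of_splits_of_roots_neg {Q : ℝ[X]} (hQ : Q.Splits)
    (hroots : ∀ r ∈ Q.roots, r < 0) (hQ0 : 0 < Q.eval 0) (hdeg : Q.natDegree ≠ 0)
    {t : ℝ} (ht : 0 ≤ t) :
    Q.eval t ≤
      Q.eval 0 * (1 + t * (Q.derivative.eval 0 / Q.eval 0) / Q.natDegree) ^ Q.natDegree := by
  have hprod : Q.eval t = Q.eval 0 * (Q.roots.map fun r => 1 + t * (1 / (0 - r))).prod := by
    rw [hQ.eval_eq_prod_roots t, hQ.eval_eq_prod_roots 0, mul_assoc, ← Multiset.prod_map_mul]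
    congr 2
    refine Multiset.map_congr rfl fun r hr => ?_
    have := (hroots r hr).ne
    field_simp
    ring
  have hsum : (Q.roots.map fun r => 1 + t * (1 / (0 - r))).sum =
      Q.natDegree + t * (Q.derivative.eval 0 / Q.eval 0) := by
    rw [hQ.eval_derivative_div_eval_of_ne_zero hQ0.ne', Multiset.sum_map_add,
      Multiset.sum_map_mul_left, hQ.natDegree_eq_card_roots]
    simp
  have hle := multiset_prod_le_pow_sum_div_card (Q.roots.map fun r => 1 + t * (1 / (0 - r))) <| by
    simp only [Multiset.mem_map, zero_sub]
    rintro _ ⟨r, hr, rfl⟩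
    have := neg_pos.mpr (hroots r hr)
    positivity
  have hdeg' : (Q.natDegree : ℝ) ≠ 0 := by exact_mod_cast hdeg
  rw [hsum, Multiset.card_map, ← hQ.natDegree_eq_card_roots, add_div, div_self hdeg'] at hle
  rw [hprod]
  gcongr

theorem derivative_eval_zero_pos_of_splits_of_roots_neg {Q : ℝ[X]} (hQ : Q.Splits)
    (hroots : ∀ r ∈ Q.roots, r < 0) (hQ0 : 0 < Q.eval 0) (hdeg : Q.natDegree ≠ 0) :
    0 < Q.derivative.eval 0 := by
  have hne : Q.roots ≠ 0 := hQ.roots_ne_zero hdeg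
  have hquot : 0 < Q.derivative.eval 0 / Q.eval 0 := by
    rw [hQ.eval_derivative_div_eval_of_ne_zero hQ0.ne']
    calc (0 : ℝ) = (Q.roots.map fun _ => (0 : ℝ)).sum := by simp
      _ < (Q.roots.map fun r => 1 / (0 - r)).sum :=
          Multiset.sum_lt_sum_of_nonempty hne fun r hr => by
            have : 0 < 0 - r := sub_pos.mpr (hroots r hr)
            positivity
  exact (div_pos_iff_of_pos_right hQ0).mp hquot

theorem mul_pow_le_derivative_eval_zero {Q : ℝ[X]} (hQ : Q.Splits)
    (hroots : ∀ r ∈ Q.roots, r < 0) (hQ0 : 0 < Q.eval 0) {k : ℕ} (hdeg : Q.natDegree = k + 2)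
    {c : ℝ} (hc : ∀ t, 0 < t → c * t ≤ Q.eval t) :
    c * ((k + 1) / (k + 2)) ^ (k + 1) ≤ Q.derivative.eval 0 := by
  have hdeg0 : Q.natDegree ≠ 0 := by lia
  have hb := derivative_eval_zero_pos_of_splits_of_roots_neg hQ hroots hQ0 hdeg0
  set a := Q.eval 0
  set b := Q.derivative.eval 0
  set ρ : ℝ := (k + 1) / (k + 2) with hρ
  have hρ0 : 0 < ρ := by positivity
  -- This `t` minimises `(1 + t * (b / a) / (k + 2)) ^ (k + 2) / t`.
  set t : ℝ := (k + 2) / (k + 1) * (a / b) with ht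
  have ht0 : 0 < t := by positivity
  have hbase : 1 + t * (b / a) / (k + 2) = ρ⁻¹ := by
    rw [ht, hρ]
    field_simp
    ring
  have hle : c * t ≤ a * ρ⁻¹ ^ (k + 2) := by
    have h := (hc t ht0).trans (eval_le_pow_of_splits_of_roots_neg hQ hroots hQ0 hdeg0 ht0.le)
    rw [hdeg] at h
    push_cast at h
    rwa [hbase] at h
  calc c * ρ ^ (k + 1) = c * t * (b / a * ρ ^ (k + 2)) := by
        rw [show t = ρ⁻¹ * (a / b) by rw [ht, hρ, inv_div]]
        field_simp
        ring
    _ ≤ a * ρ⁻¹ ^ (k + 2) * (b / a * ρ ^ (k + 2)) := by gcongr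
    _ = b := by
        rw [inv_pow]
        field_simp

theorem derivative_eval_zero_ne_zero_of_roots_re_neg {Q : ℂ[X]} (hdeg : Q.natDegree ≠ 0)
    (hQ : ∀ z ∈ Q.rootSet ℂ, z.re < 0) : Q.derivative.eval 0 ≠ 0 := by
  intro h0
  have hderiv : Q.derivative ≠ 0 := mt derivative_eq_zero.mp hdeg
  have hmem : (0 : ℂ) ∈ convexHull ℝ (Q.rootSet ℂ) :=
    rootSet_derivative_subset_convexHull_rootSet
      (natDegree_pos_iff_degree_pos.mp (Nat.pos_of_ne_zero hdeg))
      (mem_rootSet.mpr ⟨hderiv, by simpa using h0⟩)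
  have hre : (0 : ℂ).re < 0 := convexHull_min hQ (convex_halfSpace_re_lt 0) hmem
  exact lt_irrefl _ hre

theorem splits_of_complex_roots_im_eq_zero {Q : ℝ[X]}
    (hQ : ∀ z : ℂ, aeval z Q = 0 → z.im = 0) : Q.Splits := by
  refine (IsAlgClosed.splits (Q.map (algebraMap ℝ ℂ))).of_splits_map _ fun z hz => ?_
  have him : z.im = 0 := hQ z (by simpa [aeval_def, eval_map] using isRoot_of_mem_roots hz)
  exact ⟨z.re, Complex.ext rfl (by simpa using him.symm)⟩

end Univariate

section Slices

open MvPolynomial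

variable {R K : Type*} [CommSemiring R] [CommSemiring K] [Algebra R K] {n d : ℕ}

/-- The univariate polynomial `t ↦ p (t, z)`, in which the variables of `p` other than the zeroth
have been given the values `z`. The values may lie in an algebra over the coefficient ring, so that
real polynomials have slices at complex points. -/
noncomputable def slice (p : MvPolynomial (Fin (n + 1)) R) (z : Fin n → K) : Polynomial K :=
  (finSuccEquiv R n p).map (aeval z : MvPolynomial (Fin n) R →ₐ[R] K).toRingHom

theorem coeff_slice (p : MvPolynomial (Fin (n + 1)) R) (z : Fin n → K) (i : ℕ) :
    (slice p z).coeff i = aeval z ((finSuccEquiv R n p).coeff i) :=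
  Polynomial.coeff_map _ _

theorem eval_slice (p : MvPolynomial (Fin (n + 1)) R) (z : Fin n → K) (t : K) :
    (slice p z).eval t = aeval (Fin.cons t z : Fin (n + 1) → K) p := by
  induction p using MvPolynomial.induction_on with
  | C r => simp [slice, finSuccEquiv_apply, Algebra.algebraMap_eq_smul_one]
  | add p q hp hq => simp_all [slice]
  | mul_X p j hp =>
    refine Fin.cases ?_ (fun j => ?_) j <;>
      simp_all [slice, finSuccEquiv_X_zero, finSuccEquiv_X_succ]

theorem map_slice {L : Type*} [CommSemiring L] [Algebra R L] [Algebra K L] [IsScalarTower R K L]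
    (p : MvPolynomial (Fin (n + 1)) R) (z : Fin n → K) :
    (slice p z).map (algebraMap K L) = slice p (algebraMap K L ∘ z) := by
  ext i
  rw [Polynomial.coeff_map, coeff_slice, coeff_slice]
  exact (aeval_algebraMap_apply L z _).symm

theorem natDegree_slice_le {p : MvPolynomial (Fin (n + 1)) R} (hp : p.IsHomogeneous d)
    (z : Fin n → K) : (slice p z).natDegree ≤ d :=
  calc (slice p z).natDegree ≤ (finSuccEquiv R n p).natDegree := Polynomial.natDegree_map_le
    _ = p.degreeOf 0 := natDegree_finSuccEquiv p
    _ ≤ p.totalDegree := degreeOf_le_totalDegree p 0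
    _ ≤ d := hp.totalDegree_le

theorem aeval_smul_of_isHomogeneous {σ : Type*} {p : MvPolynomial σ R} (hp : p.IsHomogeneous d)
    (c : K) (z : σ → K) : aeval (c • z) p = c ^ d * aeval z p := by
  simp only [aeval_def, eval₂_eq, Finset.mul_sum, Pi.smul_apply, smul_eq_mul, mul_pow,
    Finset.prod_mul_distrib, Finset.prod_pow_eq_pow_sum]
  refine Finset.sum_congr rfl fun m hm => ?_
  rw [← hp.degree_eq_sum_deg_support hm]
  ring

theorem coeff_slice_of_isHomogeneous {p : MvPolynomial (Fin (n + 1)) R} (hp : p.IsHomogeneous d)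
    (z : Fin n → K) : (slice p z).coeff d = aeval (Fin.cons 1 0 : Fin (n + 1) → K) p := by
  obtain ⟨c, hc⟩ : ∃ c, (finSuccEquiv R n p).coeff d = C c :=
    ⟨_, totalDegree_eq_zero_iff_eq_C.mp (Nat.le_zero.mp
      (hp.finSuccEquiv_coeff_isHomogeneous d 0 (add_zero d)).totalDegree_le)⟩
  have hlow : ∀ i ∈ Finset.range d, (slice p (0 : Fin n → K)).coeff i = 0 := fun i hi => by
    have hid := Finset.mem_range.mp hi
    have hd : d - i ≠ 0 := Nat.sub_ne_zero_of_lt hid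
    rw [coeff_slice]
    simpa [hd] using aeval_smul_of_isHomogeneous
      (hp.finSuccEquiv_coeff_isHomogeneous i (d - i) (by lia)) 0 (0 : Fin n → K)
  rw [← eval_slice, Polynomial.eval_eq_sum_range' (Nat.lt_succ_of_le (natDegree_slice_le hp 0)),
    Finset.sum_range_succ, Finset.sum_eq_zero fun i hi => by rw [hlow i hi, zero_mul]]
  simp [coeff_slice, hc]

end Slices

section Stability

open MvPolynomial

variable {σ τ : Type*} {n d : ℕ}

/-- A strict form of H-stability: `p` does not vanish at complex points whose coordinates all lie
in the closed right half-plane and not all on its boundary. Admitting boundary coordinates makes the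
property pass to the coefficients of `finSuccEquiv` without a limiting argument. -/
def IsStrictlyHStable (p : MvPolynomial σ ℝ) : Prop :=
  ∀ z : σ → ℂ, (∀ j, 0 ≤ (z j).re) → (∃ j, 0 < (z j).re) → aeval z p ≠ 0

namespace IsStrictlyHStable

theorem rename_equiv {p : MvPolynomial σ ℝ} (hp : IsStrictlyHStable p) (e : σ ≃ τ) :
    IsStrictlyHStable (rename e p) := by
  rintro z hz ⟨j, hj⟩
  rw [aeval_rename]
  exact hp _ (fun i => hz (e i)) ⟨e.symm j, by simpa using hj⟩

theorem eval_ne_zero {p : MvPolynomial σ ℝ} (hp : IsStrictlyHStable p) {x : σ → ℝ}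
    (hx : ∀ j, 0 ≤ x j) (hpos : ∃ j, 0 < x j) : eval x p ≠ 0 := by
  have h := hp (algebraMap ℝ ℂ ∘ x) (by simpa using hx) (by simpa using hpos)
  rw [aeval_algebraMap_apply] at h
  exact (map_ne_zero (algebraMap ℝ ℂ)).mp h

variable {p : MvPolynomial (Fin (n + 1)) ℝ}

theorem natDegree_slice (hp : IsStrictlyHStable p) (hd : p.IsHomogeneous d) (z : Fin n → ℂ) :
    (slice p z).natDegree = d := by
  refine le_antisymm (natDegree_slice_le hd z) (Polynomial.le_natDegree_of_ne_zero ?_)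
  rw [coeff_slice_of_isHomogeneous hd]
  exact hp _ (Fin.cases (by simp) (by simp)) ⟨0, by simp⟩

theorem natDegree_slice_real (hp : IsStrictlyHStable p) (hd : p.IsHomogeneous d) (x : Fin n → ℝ) :
    (slice p x).natDegree = d := by
  rw [← Polynomial.natDegree_map (algebraMap ℝ ℂ), map_slice, hp.natDegree_slice hd]

theorem coeff_one (hp : IsStrictlyHStable p) (hd : p.IsHomogeneous d) (hd0 : d ≠ 0) :
    IsStrictlyHStable ((finSuccEquiv ℝ n p).coeff 1) := by
  rintro z hz ⟨j, hj⟩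
  have hdeg : (slice p z).natDegree ≠ 0 := by rwa [hp.natDegree_slice hd]
  have hroots : ∀ t ∈ (slice p z).rootSet ℂ, t.re < 0 := fun t ht => by
    by_contra! hre
    refine hp (Fin.cons t z) (Fin.cases hre hz) ⟨j.succ, hj⟩ ?_
    simpa [eval_slice] using (Polynomial.mem_rootSet.mp ht).2
  rw [← coeff_slice, ← eval_zero_derivative]
  exact derivative_eval_zero_ne_zero_of_roots_re_neg hdeg hroots

-- Multiplying a zero `(t, x)` by `-(im t) i` gives a zero with real parts `((im t)², 0)`.
theorem splits_slice (hp : IsStrictlyHStable p) (hd : p.IsHomogeneous d) (x : Fin n → ℝ) :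
    (slice p x).Splits := by
  refine splits_of_complex_roots_im_eq_zero fun t ht => ?_
  by_contra him
  set c : ℂ := -t.im * Complex.I
  have hzero : aeval (Fin.cons t (algebraMap ℝ ℂ ∘ x) : Fin (n + 1) → ℂ) p = 0 := by
    rwa [← eval_slice, ← map_slice, Polynomial.eval_map_algebraMap]
  have hct : 0 < (c * t).re := by
    have : (c * t).re = t.im * t.im := by simp [c]
    rw [this]
    exact mul_self_pos.mpr him
  refine hp (c • Fin.cons t (algebraMap ℝ ℂ ∘ x)) (Fin.cases hct.le fun j => by simp [c])
    ⟨0, hct⟩ ?_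
  rw [aeval_smul_of_isHomogeneous hd, hzero, mul_zero]

theorem roots_slice_neg (hp : IsStrictlyHStable p) {x : Fin n → ℝ} (hx : ∀ j, 0 ≤ x j)
    (hpos : ∃ j, 0 < x j) {r : ℝ} (hr : r ∈ (slice p x).roots) : r < 0 := by
  by_contra! hr0
  obtain ⟨j, hj⟩ := hpos
  refine hp.eval_ne_zero (x := Fin.cons r x) (Fin.cases hr0 hx) ⟨j.succ, hj⟩ ?_
  rw [← coe_aeval_eq_eval, RingHom.coe_coe, ← eval_slice]
  exact Polynomial.isRoot_of_mem_roots hr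

end IsStrictlyHStable

end Stability

section Capacity

open MvPolynomial

variable {σ τ : Type*} {n : ℕ}

theorem eval_nonneg_of_coeff_nonneg {p : MvPolynomial σ ℝ} (hp : ∀ m, 0 ≤ coeff m p) {x : σ → ℝ}
    (hx : ∀ j, 0 ≤ x j) : 0 ≤ eval x p := by
  rw [eval_eq]
  exact Finset.sum_nonneg fun m _ =>
    mul_nonneg (hp m) (Finset.prod_nonneg fun j _ => pow_nonneg (hx j) _)

variable [Fintype σ] [Fintype τ]

/-- The capacity of a polynomial, the infimum of `p x / ∏ j, x j` over the positive orthant. It is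
meaningful when `p` has nonnegative coefficients; a quotient unbounded below has infimum `0`. -/
noncomputable def capacity (p : MvPolynomial σ ℝ) : ℝ :=
  ⨅ x : {x : σ → ℝ // ∀ j, 0 < x j}, eval x.1 p / ∏ j, x.1 j

theorem capacity_mul_prod_le_eval {p : MvPolynomial σ ℝ} (hp : ∀ m, 0 ≤ coeff m p) {x : σ → ℝ}
    (hx : ∀ j, 0 < x j) : capacity p * ∏ j, x j ≤ eval x p := by
  have hbdd : BddBelow (Set.range fun y : {y : σ → ℝ // ∀ j, 0 < y j} =>
      eval y.1 p / ∏ j, y.1 j) := by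
    refine ⟨0, ?_⟩
    rintro _ ⟨⟨y, hy⟩, rfl⟩
    exact div_nonneg (eval_nonneg_of_coeff_nonneg hp fun j => (hy j).le)
      (Finset.prod_nonneg fun j _ => (hy j).le)
  rw [← le_div_iff₀ (Finset.prod_pos fun j _ => hx j)]
  exact ciInf_le hbdd ⟨x, hx⟩

theorem le_capacity {p : MvPolynomial σ ℝ} {c : ℝ}
    (hc : ∀ x : σ → ℝ, (∀ j, 0 < x j) → c * ∏ j, x j ≤ eval x p) : c ≤ capacity p := by
  have : Nonempty {x : σ → ℝ // ∀ j, 0 < x j} := ⟨⟨fun _ => 1, fun _ => zero_lt_one⟩⟩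
  refine le_ciInf fun ⟨x, hx⟩ => ?_
  rw [le_div_iff₀ (Finset.prod_pos fun j _ => hx j)]
  exact hc x hx

theorem capacity_le_capacity_rename_equiv {p : MvPolynomial σ ℝ} (hp : ∀ m, 0 ≤ coeff m p)
    (e : σ ≃ τ) : capacity p ≤ capacity (rename e p) := by
  refine le_capacity fun x hx => ?_
  rw [eval_rename, ← e.prod_comp]
  exact capacity_mul_prod_le_eval hp fun j => hx (e j)

theorem capacity_mul_pow_le_capacity_coeff_one {p : MvPolynomial (Fin (n + 1)) ℝ}
    (hp : IsStrictlyHStable p) (hd : p.IsHomogeneous (n + 1)) (hcoeff : ∀ m, 0 ≤ coeff m p) :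
    capacity p * (n / (n + 1)) ^ n ≤ capacity ((finSuccEquiv ℝ n p).coeff 1) := by
  refine le_capacity fun x hx => ?_
  have heval : ∀ t, (slice p x).eval t = eval (Fin.cons t x) p := eval_slice p x
  have hcap : ∀ t, 0 < t → capacity p * (∏ j, x j) * t ≤ (slice p x).eval t := fun t ht => by
    have := capacity_mul_prod_le_eval hcoeff (x := Fin.cons t x) (Fin.cases ht hx)
    rw [heval]
    simpa [Fin.prod_univ_succ, mul_assoc, mul_comm t] using this
  rw [mul_right_comm, ← coe_aeval_eq_eval, RingHom.coe_coe, ← coeff_slice]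
  cases n with
  | zero =>
    have h1 := hcap 1 one_pos
    rw [eval_slice, Subsingleton.elim x 0, ← coeff_slice_of_isHomogeneous hd x] at h1
    simpa using h1
  | succ k =>
    have hx0 : ∀ j, 0 ≤ (Fin.cons 0 x : Fin (k + 2) → ℝ) j :=
      Fin.cases le_rfl fun j => (hx j).le
    have hQ0 : 0 < (slice p x).eval 0 := by
      rw [heval]
      exact (eval_nonneg_of_coeff_nonneg hcoeff hx0).lt_of_ne'
        (hp.eval_ne_zero hx0 ⟨Fin.succ 0, hx 0⟩)
    have := mul_pow_le_derivative_eval_zero (hp.splits_slice hd x)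
      (fun r hr => hp.roots_slice_neg (fun j => (hx j).le) ⟨0, hx 0⟩ hr) hQ0
      (hp.natDegree_slice_real hd x) hcap
    rw [eval_zero_derivative] at this
    convert this using 4 <;> push_cast <;> ring

theorem factorial_div_pow_succ (n : ℕ) :
    ((n + 1)! : ℝ) / ((n + 1 : ℕ) : ℝ) ^ (n + 1) = n ! / n ^ n * (n / (n + 1)) ^ n := by
  rcases eq_or_ne n 0 with rfl | hn
  · simp
  have : (n : ℝ) ≠ 0 := by exact_mod_cast hn
  rw [Nat.factorial_succ, div_pow]
  push_cast
  field_simp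
  ring

theorem factorial_div_pow_mul_capacity_le_coeff_fin {p : MvPolynomial (Fin n) ℝ}
    (hp : IsStrictlyHStable p) (hd : p.IsHomogeneous n) (hcoeff : ∀ m, 0 ≤ coeff m p) :
    (n ! : ℝ) / n ^ n * capacity p ≤ coeff (Finsupp.equivFunOnFinite.symm 1) p := by
  induction n with
  | zero =>
    have h := capacity_mul_prod_le_eval hcoeff (x := 0) (fun j => j.elim0)
    rw [eval_zero, constantCoeff_eq] at h
    simpa [Subsingleton.elim (Finsupp.equivFunOnFinite.symm 1) 0] using h
  | succ n ih =>
    have hones : (Finsupp.equivFunOnFinite.symm 1 : Fin (n + 1) →₀ ℕ) =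
        (Finsupp.equivFunOnFinite.symm 1 : Fin n →₀ ℕ).cons 1 := by
      ext j
      refine Fin.cases ?_ (fun j => ?_) j <;> simp
    calc ((n + 1)! : ℝ) / ((n + 1 : ℕ) : ℝ) ^ (n + 1) * capacity p
        = n ! / n ^ n * (capacity p * (n / (n + 1)) ^ n) := by
          rw [factorial_div_pow_succ]
          ring
      _ ≤ n ! / n ^ n * capacity ((finSuccEquiv ℝ n p).coeff 1) := by
          gcongr
          exact capacity_mul_pow_le_capacity_coeff_one hp hd hcoeff
      _ ≤ coeff (Finsupp.equivFunOnFinite.symm 1) ((finSuccEquiv ℝ n p).coeff 1) :=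
          ih (hp.coeff_one hd n.succ_ne_zero) (hd.finSuccEquiv_coeff_isHomogeneous 1 n (by ring))
            fun m => by
              rw [finSuccEquiv_coeff_coeff]
              exact hcoeff _
      _ = coeff (Finsupp.equivFunOnFinite.symm 1) p := by
          rw [finSuccEquiv_coeff_coeff, hones]

theorem factorial_div_pow_mul_capacity_le_coeff {p : MvPolynomial σ ℝ}
    (hp : IsStrictlyHStable p) (hd : p.IsHomogeneous (Fintype.card σ))
    (hcoeff : ∀ m, 0 ≤ coeff m p) :
    ((Fintype.card σ)! : ℝ) / (Fintype.card σ : ℝ) ^ Fintype.card σ * capacity p ≤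
      coeff (Finsupp.equivFunOnFinite.symm 1) p := by
  let e := Fintype.equivFin σ
  have hrename : ∀ m, coeff m (rename e p) = coeff (m.mapDomain e.symm) p := fun m => by
    rw [← coeff_rename_mapDomain e e.injective, ← Finsupp.mapDomain_comp]
    simp
  calc _ ≤ ((Fintype.card σ)! : ℝ) / (Fintype.card σ : ℝ) ^ Fintype.card σ *
          capacity (rename e p) := by
        gcongr
        exact capacity_le_capacity_rename_equiv hcoeff e
    _ ≤ coeff (Finsupp.equivFunOnFinite.symm 1) (rename e p) :=
        factorial_div_pow_mul_capacity_le_coeff_fin (hp.rename_equiv e)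
          hd.rename_isHomogeneous fun m => (hcoeff _).trans_eq (hrename m).symm
    _ = coeff (Finsupp.equivFunOnFinite.symm 1) p := by
        rw [hrename]
        congr 1
        ext j
        simp [← Finsupp.equivMapDomain_eq_mapDomain]

end Capacity

section Permanent

open MvPolynomial Matrix

variable {m n R : Type*} [Fintype m] [Fintype n] [CommSemiring R]

/-- The product of the linear forms given by the rows of `A`. Gurvits' inequality for this
polynomial bounds the permanent of `A`, which is its coefficient at `∏ j, X j`. -/
noncomputable def rowProduct (A : Matrix m n R) : MvPolynomial n R :=
  ∏ i, ∑ j, C (A i j) * X j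

theorem eval_rowProduct (A : Matrix m n R) (x : n → R) :
    eval x (rowProduct A) = ∏ i, ∑ j, A i j * x j := by
  simp [rowProduct]

theorem isHomogeneous_rowProduct (A : Matrix m n R) :
    (rowProduct A).IsHomogeneous (Fintype.card m) := by
  have hrow : ∀ i, (∑ j, C (A i j) * X j : MvPolynomial n R).IsHomogeneous 1 := fun i =>
    IsHomogeneous.sum _ _ _ fun j _ => by
      simpa using (isHomogeneous_C n (A i j)).mul (isHomogeneous_X R j)
  simpa [rowProduct] using IsHomogeneous.prod Finset.univ _ _ fun i _ => hrow i

theorem isStrictlyHStable_rowProduct {A : Matrix m n ℝ} (hA : ∀ i j, 0 < A i j) :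
    IsStrictlyHStable (rowProduct A) := by
  rintro z hz ⟨k, hk⟩
  simp only [rowProduct, map_prod, map_sum, map_mul, aeval_C, aeval_X]
  refine Finset.prod_ne_zero_iff.mpr fun i _ h0 => ?_
  have hre : 0 < ∑ j, A i j * (z j).re :=
    Finset.sum_pos' (fun j _ => mul_nonneg (hA i j).le (hz j))
      ⟨k, Finset.mem_univ k, mul_pos (hA i k) hk⟩
  refine hre.ne' ?_
  simpa using congrArg Complex.re h0

theorem rowProduct_eq_sum_monomial [DecidableEq m] (A : Matrix m n R) :
    rowProduct A = ∑ f : m → n, monomial (∑ i, Finsupp.single (f i) 1) (∏ i, A i (f i)) := by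
  simp only [rowProduct, monomial_sum_prod, C_mul_X_eq_monomial, Finset.prod_univ_sum,
    Fintype.piFinset_univ]

theorem coeff_rowProduct_nonneg {A : Matrix m n ℝ} (hA : ∀ i j, 0 ≤ A i j) (e : n →₀ ℕ) :
    0 ≤ coeff e (rowProduct A) := by
  classical
  rw [rowProduct_eq_sum_monomial, coeff_sum]
  refine Finset.sum_nonneg fun f _ => ?_
  rw [coeff_monomial]
  split_ifs
  exacts [Finset.prod_nonneg fun i _ => hA i (f i), le_rfl]

theorem sum_single_eq_ones_iff_bijective {κ : Type*} [Finite κ] (f : m → κ) :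
    ∑ i, Finsupp.single (f i) 1 = (Finsupp.equivFunOnFinite.symm 1 : κ →₀ ℕ) ↔
      Function.Bijective f := by
  classical
  have hfiber : ∀ j, (∑ i, Finsupp.single (f i) 1 : κ →₀ ℕ) j = Finset.card {i | f i = j} :=
    fun j => by simp [Finsupp.finsetSum_apply, Finsupp.single_apply]
  simp only [Finsupp.ext_iff, hfiber, Function.bijective_iff_existsUnique]
  simp [Finset.card_eq_one_iff_existsUnique, Finset.mem_filter]

theorem coeff_rowProduct_ones [DecidableEq n] (A : Matrix n n R) :
    coeff (Finsupp.equivFunOnFinite.symm 1) (rowProduct A) = A.permanent := by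
  rw [rowProduct_eq_sum_monomial, coeff_sum, ← permanent_transpose]
  simp only [coeff_monomial, sum_single_eq_ones_iff_bijective, permanent, transpose_apply]
  rw [← Finset.sum_filter]
  exact (Finset.sum_bij (fun (σ : Equiv.Perm n) _ => ⇑σ) (fun _ _ => by simp)
    (fun _ _ _ _ h => DFunLike.coe_injective h)
    (fun f hf => ⟨Equiv.ofBijective f (by simpa using hf), Finset.mem_univ _, rfl⟩)
    fun _ _ => rfl).symm

theorem capacity_rowProduct_mono {A B : Matrix m n ℝ} (hA : ∀ i j, 0 ≤ A i j)
    (hAB : ∀ i j, A i j ≤ B i j) : capacity (rowProduct A) ≤ capacity (rowProduct B) := by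
  refine le_capacity fun x hx =>
    (capacity_mul_prod_le_eval (coeff_rowProduct_nonneg hA) hx).trans ?_
  rw [eval_rowProduct, eval_rowProduct]
  exact Finset.prod_le_prod
    (fun i _ => Finset.sum_nonneg fun j _ => mul_nonneg (hA i j) (hx j).le)
    fun i _ => Finset.sum_le_sum fun j _ => mul_le_mul_of_nonneg_right (hAB i j) (hx j).le

theorem factorial_div_pow_mul_capacity_le_permanent_of_pos [DecidableEq n] {A : Matrix n n ℝ}
    (hA : ∀ i j, 0 < A i j) :
    ((Fintype.card n)! : ℝ) / (Fintype.card n : ℝ) ^ Fintype.card n * capacity (rowProduct A) ≤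
      A.permanent := by
  rw [← coeff_rowProduct_ones]
  exact factorial_div_pow_mul_capacity_le_coeff (isStrictlyHStable_rowProduct hA)
    (isHomogeneous_rowProduct A) (coeff_rowProduct_nonneg fun i j => (hA i j).le)

theorem factorial_div_pow_mul_capacity_le_permanent [DecidableEq n] {A : Matrix n n ℝ}
    (hA : ∀ i j, 0 ≤ A i j) :
    ((Fintype.card n)! : ℝ) / (Fintype.card n : ℝ) ^ Fintype.card n * capacity (rowProduct A) ≤
      A.permanent := by
  have hcont : Continuous fun ε : ℝ => (of fun i j => A i j + ε).permanent := by
    simp only [permanent, of_apply]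
    fun_prop
  have hlim := (hcont.tendsto 0).mono_left (nhdsWithin_le_nhds (s := Set.Ioi 0))
  simp only [add_zero] at hlim
  refine ge_of_tendsto hlim ?_
  filter_upwards [self_mem_nhdsWithin] with ε (hε : 0 < ε)
  refine le_trans ?_ (factorial_div_pow_mul_capacity_le_permanent_of_pos
    fun i j => add_pos_of_nonneg_of_pos (hA i j) hε)
  gcongr
  exact capacity_rowProduct_mono hA fun i j => le_add_of_nonneg_right hε.le

theorem prod_rpow_le_capacity_rowProduct_hadamard [DecidableEq n] {B : Matrix n n ℝ}
    (hB : B ∈ doublyStochastic ℝ n) {W : Matrix n n ℝ} (hW : ∀ i j, 0 ≤ W i j) :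
    ∏ i, ∏ j, W i j ^ B i j ≤ capacity (rowProduct (B ⊙ W)) := by
  obtain ⟨h0, hrow, hcol⟩ := mem_doublyStochastic_iff_sum.mp hB
  refine le_capacity fun x hx => ?_
  have hWx : ∀ i j, 0 ≤ W i j * x j := fun i j => mul_nonneg (hW i j) (hx j).le
  have hprod : ∏ i, ∏ j, x j ^ B i j = ∏ j, x j := by
    rw [Finset.prod_comm]
    refine Finset.prod_congr rfl fun j _ => ?_
    rw [← Real.rpow_sum_of_pos (hx j), hcol j, Real.rpow_one]
  calc (∏ i, ∏ j, W i j ^ B i j) * ∏ j, x j = ∏ i, ∏ j, (W i j * x j) ^ B i j := by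
        simp only [Real.mul_rpow (hW _ _) (hx _).le, Finset.prod_mul_distrib, hprod]
    _ ≤ ∏ i, ∑ j, B i j * (W i j * x j) := by
        gcongr with i
        · exact fun i _ => Finset.prod_nonneg fun j _ => Real.rpow_nonneg (hWx i j) _
        · exact Real.geom_mean_le_arith_mean_weighted Finset.univ (B i) _ (fun j _ => h0 i j)
            (hrow i) fun j _ => hWx i j
    _ = eval x (rowProduct (B ⊙ W)) := by
        simp only [eval_rowProduct, hadamard_apply, mul_assoc]

end Permanent

open Matrix in
theorem corollary1_general {n : Type*} [Fintype n] [DecidableEq n] {B : Matrix n n ℝ}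
    (hB : B ∈ doublyStochastic ℝ n) {W : Matrix n n ℝ} (hW : ∀ i j, 0 ≤ W i j) :
    ((Fintype.card n)! : ℝ) / (Fintype.card n : ℝ) ^ Fintype.card n * ∏ i, ∏ j, W i j ^ B i j ≤
      (B ⊙ W).permanent := by
  refine le_trans ?_ (factorial_div_pow_mul_capacity_le_permanent fun i j =>
    mul_nonneg (nonneg_of_mem_doublyStochastic hB) (hW i j))
  gcongr
  exact prod_rpow_le_capacity_rowProduct_hadamard hB hW

theorem corollary1 (N : ℕ) :
    (∀ (p : Matrix (Fin N) (Fin N) ℝ) (T : ℝ) (β : Matrix (Fin N) (Fin N) ℝ),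
      (∀ i j, 0 ≤ p i j) → 0 < T → IsBPBelief p T β →
        (N ! : ℝ) / (N : ℝ) ^ N * ∏ i, ∏ j, (1 - β i j) ^ β i j
          ≤ (beliefVariance β).permanent) ∧
    (∀ β ∈ doublyStochastic ℝ (Fin N),
        (N ! : ℝ) / (N : ℝ) ^ N * ∏ i, ∏ j, (1 - β i j) ^ β i j
          ≤ (beliefVariance β).permanent) := by
  have bound : ∀ β ∈ doublyStochastic ℝ (Fin N),
      (N ! : ℝ) / (N : ℝ) ^ N * ∏ i, ∏ j, (1 - β i j) ^ β i j ≤ (beliefVariance β).permanent :=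
    fun β hβ => by
      have h := corollary1_general hβ (W := Matrix.of fun i j => 1 - β i j) fun i j =>
        sub_nonneg.mpr (le_one_of_mem_doublyStochastic hβ)
      rwa [Fintype.card_fin] at h
  exact ⟨fun _ _ β _ _ h => bound β h.doublyStochastic, bound⟩
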